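/- Let $G$ be a connected undirected graph on $n$ nodes with Laplacian matrix $\mathcal L\in\mathbb R^{n\times n}$, let $d\in\mathbb R$, $0<\underline K\le\overline K$, and $\Sigma=\{1,\dots,M\}$. For each $\sigma\in\Sigma$ let $\phi_\sigma(q)=\sum_{i=1}^n\phi_{i,\sigma}(q_i)$, $\phi_\sigma:\mathbb R^n\to\mathbb R$, be continuously differentiable and convex, with compact sublevel sets and Lipschitz gradient, and suppose that the problem $\min_{q\in\mathbb R^n}\phi_\sigma(q)$ subject to $\mathbb 1^Tq=d$ has a unique solution $q_\sigma^*$. For $z=(q,p)\in\mathbb R^{2n}$ put $$F_\sigma(z)=\{(p,\,-kp-\mathcal L\nabla\phi_\sigma(q)) : k\in\kappa_\sigma(z)\},\qquad C=\{(q,p)\in\mathbb R^{2n}:\mathbb 1^Tq=d,\ \mathbb 1^Tp=0\},$$ where $\kappa_\sigma(z)$ is $\{\overline K\}$, $\{\underline K\}$ or $[\underline K,\overline K]$ according as $\langle\mathcal L\nabla\phi_\sigma(q),p\rangle$ is positive, negative or zero. Then for each $\sigma\in\Sigma$ the set-valued map $F_\sigma$ is outer semicontinuous and locally bounded relative to $C$,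 $F_\sigma(z)$ is nonempty and convex for every $z\in C$, and the point $z_\sigma^*=(q_\sigma^*,0)$ is globally asymptotically stable for the constrained differential inclusion $\dot z\in F_\sigma(z)$, $z\in C$. Here a solution is a locally absolutely continuous $z:I\to C$ on an interval $I\subseteq[0,\infty)$ containing $0$ with $\dot z(t)\in F_\sigma(z(t))$ for almost every $t\in I$; it is complete if $I$ is unbounded. The point $z^*$ is globally asymptotically stable if (i) for every $\varepsilon>0$ there is $\delta>0$ such that every solution with $|z(0)-z^*|\le\delta$ satisfies $|z(t)-z^*|\le\varepsilon$ for all $t\in I$, and (ii) every solution is bounded and, if complete, converges to $z^*$ as $t\to\infty$. -/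

import Mathlib

open Set Filter Topology MeasureTheory
open scoped NNReal

noncomputable section

namespace HiHBM

/-! ### Constrained differential inclusions and their stability notions -/

section Inclusion

variable {X : Type*} [NormedAddCommGroup X] [NormedSpace ℝ X]

/-- `z`, restricted to the time domain `I`, is a solution of `ż ∈ F z`, `z ∈ C`: `I` is an interval
of nonnegative times with left end point `0 ∈ I` (it may be `{0}`, `[0,T]`, `[0,T)` or `[0,∞)`), `z`
is locally absolutely continuous on `I`, stays in `C`, and satisfies `ż ∈ F z` at almost every time.
Values of `z` outside `I` play no role. -/
structure IsSolution (F : X → Set X) (C : Set X) (I : Set ℝ) (z : ℝ → X) : Prop where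
  zero_mem : (0 : ℝ) ∈ I
  nonneg : I ⊆ Ici 0
  ordConnected : I.OrdConnected
  absCont : ∀ t ∈ I, AbsolutelyContinuousOnInterval z 0 t
  mem_constraint : ∀ t ∈ I, z t ∈ C
  deriv_mem : ∀ᵐ t ∂(volume : Measure ℝ), t ∈ interior I → ∃ v ∈ F (z t), HasDerivAt z v t

/-- The solution is bounded and, if complete (unbounded time domain), its distance to `A` tends
to zero. -/
def BoundedAndConverges (A : Set X) (I : Set ℝ) (z : ℝ → X) : Prop :=
  Bornology.IsBounded (z '' I) ∧
    (¬ BddAbove I → Tendsto (fun t => Metric.infDist (z t) A) atTop (𝓝 0))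

/-- Stability of a (nonempty compact) set `A`. -/
def IsStable (F : X → Set X) (C A : Set X) : Prop :=
  ∀ ε > 0, ∃ δ > 0, ∀ (I : Set ℝ) (z : ℝ → X), IsSolution F C I z →
    Metric.infDist (z 0) A ≤ δ → ∀ t ∈ I, Metric.infDist (z t) A ≤ ε

/-- The set of initial conditions from which each solution is bounded and, if complete, converges
to `A`. -/
def basinOfAttraction (F : X → Set X) (C A : Set X) : Set X :=
  {x₀ | ∀ (I : Set ℝ) (z : ℝ → X), IsSolution F C I z → z 0 = x₀ → BoundedAndConverges A I z}

/-- Attractivity of a (nonempty compact) set `A`: for some `δ > 0`, each solution from the closed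
`δ`-neighbourhood of `A` is bounded and, if complete, converges to `A`. -/
def IsAttractive (F : X → Set X) (C A : Set X) : Prop :=
  ∃ δ > 0, ∀ (I : Set ℝ) (z : ℝ → X), IsSolution F C I z →
    z 0 ∈ Metric.cthickening δ A → BoundedAndConverges A I z

/-- Asymptotic stability. -/
def IsAsymptoticallyStable (F : X → Set X) (C A : Set X) : Prop :=
  IsStable F C A ∧ IsAttractive F C A

/-- Global asymptotic stability. -/
def IsGAS (F : X → Set X) (C A : Set X) : Prop :=
  IsAsymptoticallyStable F C A ∧ basinOfAttraction F C A = univ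

/-- Outer semicontinuity of a set-valued map (at every point of the space). -/
def OuterSemicontinuous (F : X → Set X) : Prop :=
  ∀ (x y : X) (xs ys : ℕ → X), Tendsto xs atTop (𝓝 x) → Tendsto ys atTop (𝓝 y) →
    (∀ i, ys i ∈ F (xs i)) → y ∈ F x

/-- Local boundedness of a set-valued map relative to `C`. -/
def LocallyBoundedRel (F : X → Set X) (C : Set X) : Prop :=
  ∀ x ∈ C, ∃ U ∈ 𝓝 x, Bornology.IsBounded (⋃ y ∈ U ∩ C, F y)

/-- The assumption on a family of constrained inclusions `ż ∈ F σ z`, `z ∈ C`, with points `zs σ`: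
each `F σ` is outer semicontinuous, locally bounded relative to `C`, with nonempty convex values
on `C` (in particular `C ⊆ dom (F σ)`), and the point `zs σ` is globally asymptotically stable. -/
structure RegularAndGAS {S : Type*} (F : S → X → Set X) (C : Set X) (zs : S → X) : Prop where
  outerSemicontinuous : ∀ σ, OuterSemicontinuous (F σ)
  locallyBounded : ∀ σ, LocallyBoundedRel (F σ) C
  nonempty : ∀ σ, ∀ z ∈ C, (F σ z).Nonempty
  convex : ∀ σ, ∀ z ∈ C, Convex ℝ (F σ z)
  gas : ∀ σ, IsGAS (F σ) C {zs σ}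

end Inclusion

/-! ### The optimization problem -/

variable {n : ℕ}

/-- The separable objective `q ↦ ∑ i, φᵢ (qᵢ)`. -/
def objective (φ : Fin n → ℝ → ℝ) (q : EuclideanSpace ℝ (Fin n)) : ℝ := ∑ i, φ i (q i)

/-- The feasible set `{q | 𝟙ᵀ q = d}`. -/
def feasible (n : ℕ) (d : ℝ) : Set (EuclideanSpace ℝ (Fin n)) := {q | ∑ i, q i = d}

/-- `q` solves the problem of minimizing `Φ` subject to `𝟙ᵀ q = d`. -/
def IsMinimizer (Φ : EuclideanSpace ℝ (Fin n) → ℝ) (d : ℝ) (q : EuclideanSpace ℝ (Fin n)) : Prop :=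
  q ∈ feasible n d ∧ ∀ w ∈ feasible n d, Φ q ≤ Φ w

/-- The standing conditions on an objective function. -/
structure ObjectiveConditions (Φ : EuclideanSpace ℝ (Fin n) → ℝ) : Prop where
  contDiff : ContDiff ℝ 1 Φ
  compact_sublevel : ∀ c : ℝ, IsCompact {q | Φ q ≤ c}
  lipschitz_gradient : ∃ L : ℝ≥0, LipschitzWith L (gradient Φ)
  convex : ConvexOn ℝ univ Φ

/-- The conditions on the switched family: every objective satisfies the standing conditions and
has a unique minimizer on the feasible set. -/
def SwitchedObjectiveConditions {S : Type*} (Φ : S → EuclideanSpace ℝ (Fin n) → ℝ) (d : ℝ) :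
    Prop :=
  ∀ σ, ObjectiveConditions (Φ σ) ∧ ∃! q, IsMinimizer (Φ σ) d q

/-! ### The Laplacian-gradient hybrid-inspired heavy ball method -/

/-- The state space `ℝⁿ × ℝⁿ = ℝ²ⁿ` with its Euclidean norm; a state is `z = (q, p)`. -/
abbrev State (n : ℕ) : Type :=
  WithLp 2 (EuclideanSpace ℝ (Fin n) × EuclideanSpace ℝ (Fin n))

/-- `ℒ ∇Φ(q)`, with `ℒ` the Laplacian matrix of the graph `G`. -/
def lapGrad (G : SimpleGraph (Fin n)) [DecidableRel G.Adj] (Φ : EuclideanSpace ℝ (Fin n) → ℝ)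
    (q : EuclideanSpace ℝ (Fin n)) : EuclideanSpace ℝ (Fin n) :=
  Matrix.toEuclideanLin (G.lapMatrix ℝ) (gradient Φ q)

/-- The set-valued damping: `{Khi}` if `⟪ℒ∇Φ(q), p⟫ > 0`, `{Klo}` if it is negative, and
`[Klo, Khi]` if it is zero. -/
def damping (G : SimpleGraph (Fin n)) [DecidableRel G.Adj] (Φ : EuclideanSpace ℝ (Fin n) → ℝ)
    (Klo Khi : ℝ) (z : State n) : Set ℝ :=
  if 0 < inner ℝ (lapGrad G Φ z.fst) z.snd then {Khi}
  else if inner ℝ (lapGrad G Φ z.fst) z.snd < 0 then {Klo}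
  else Icc Klo Khi

/-- The flow map `F (q, p) = {(p, -k p - ℒ∇Φ(q)) | k ∈ κ(q, p)}`. -/
def flowMap (G : SimpleGraph (Fin n)) [DecidableRel G.Adj] (Φ : EuclideanSpace ℝ (Fin n) → ℝ)
    (Klo Khi : ℝ) (z : State n) : Set (State n) :=
  (fun k : ℝ => WithLp.toLp 2 (z.snd, -(k • z.snd) - lapGrad G Φ z.fst)) ''
    damping G Φ Klo Khi z

/-- The flow set `{(q, p) | 𝟙ᵀ q = d, 𝟙ᵀ p = 0}`. -/
def flowSet (n : ℕ) (d : ℝ) : Set (State n) := {z | z.fst ∈ feasible n d ∧ z.snd ∈ feasible n 0}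

end HiHBM

end

noncomputable section

namespace HiHBM

/-! ### Absolutely continuous functions -/

/-! Write h(q) = ℒ∇Φ(q), and let A invert ℒ on zero-sum vectors (`exists_lap_inverse`). Since ⟪Ap,
h⟫ = ⟪∇Φ, p⟫ when 𝟙ᵀp = 0, the energy V = Φ(q) - Φ(q*) + ½⟪Ap, p⟫ has derivative -k⟪Ap, p⟫ ≤ 0 along
solutions. It is positive definite on C with compact sublevel sets, which gives stability and
boundedness.

This derivative vanishes whenever p = 0. Instead of an invariance principle, a second function W = V
+ ε⟪p, h⟫ is used. The cross term contributes -ε‖h‖², and its remaining terms are absorbed for small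
ε because h is Lipschitz (`decreasesAlong_energy`). The resulting rate D is positive on C away from
(q*, 0): if p = 0 and h = 0, connectedness makes ∇Φ a multiple of 𝟙, so q is a minimizer by
convexity, hence q = q*. The criterion `isGAS_singleton_of_lyapunov` combines V and W.

Stability uses only that k lies in [Klo, Khi]; the sign rule for the damping matters for outer
semicontinuity and convexity of values. As ∇Φ is only Lipschitz, W is differentiated almost
everywhere along absolutely continuous curves. -/

theorem AbsolutelyContinuousOnInterval.lipschitzOnWith_comp {X Y : Type*} [PseudoMetricSpace X]
    [PseudoMetricSpace Y] {f : X → Y} {g : ℝ → X} {s : Set X} {K : ℝ≥0} {a b : ℝ}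
    (hf : LipschitzOnWith K f s) (hg : AbsolutelyContinuousOnInterval g a b)
    (hs : MapsTo g (uIcc a b) s) : AbsolutelyContinuousOnInterval (f ∘ g) a b := by
  rw [absolutelyContinuousOnInterval_iff] at hg ⊢
  intro ε hε
  -- `K + 1` rather than `K`, so that the divisor is positive even when `K = 0`.
  obtain ⟨δ, hδ, h⟩ := hg (ε / (K + 1)) (by positivity)
  refine ⟨δ, hδ, fun E hE hlt => ?_⟩
  calc ∑ i ∈ Finset.range E.1, dist ((f ∘ g) (E.2 i).1) ((f ∘ g) (E.2 i).2)
      ≤ ∑ i ∈ Finset.range E.1, (K + 1 : ℝ) * dist (g (E.2 i).1) (g (E.2 i).2) := by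
        refine Finset.sum_le_sum fun i hi => ?_
        have := hf.dist_le_mul _ (hs (hE.1 i hi).1) _ (hs (hE.1 i hi).2)
        have h0 : 0 ≤ dist (g (E.2 i).1) (g (E.2 i).2) := dist_nonneg
        simp only [Function.comp_apply]
        linarith
    _ = (K + 1 : ℝ) * ∑ i ∈ Finset.range E.1, dist (g (E.2 i).1) (g (E.2 i).2) := by
        rw [Finset.mul_sum]
    _ < (K + 1 : ℝ) * (ε / (K + 1)) := by
        have := h E hE hlt
        gcongr
    _ = ε := by field_simp

theorem AbsolutelyContinuousOnInterval.locallyLipschitz_comp {X Y : Type*} [PseudoMetricSpace X]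
    [PseudoMetricSpace Y] {f : X → Y} {g : ℝ → X} {a b : ℝ}
    (hf : LocallyLipschitz f) (hg : AbsolutelyContinuousOnInterval g a b)
    (hc : ContinuousOn g (uIcc a b)) : AbsolutelyContinuousOnInterval (f ∘ g) a b := by
  obtain ⟨K, hK⟩ := (hf.locallyLipschitzOn (s := g '' uIcc a b)).exists_lipschitzOnWith_of_compact
    (isCompact_uIcc.image_of_continuousOn hc)
  exact AbsolutelyContinuousOnInterval.lipschitzOnWith_comp hK hg (mapsTo_image _ _)

/-- An absolutely continuous function whose derivative is almost everywhere at most `c` grows at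
rate at most `c`. -/
theorem AbsolutelyContinuousOnInterval.sub_le_mul_of_hasDerivAt_le {f : ℝ → ℝ} {a b c : ℝ}
    (hab : a ≤ b) (hf : AbsolutelyContinuousOnInterval f a b)
    (h : ∀ᵐ t, t ∈ Ioo a b → ∃ v ≤ c, HasDerivAt f v t) : f b - f a ≤ c * (b - a) := by
  rw [← hf.integral_deriv_eq_sub]
  calc ∫ t in a..b, deriv f t ≤ ∫ _ in a..b, c := by
        refine intervalIntegral.integral_mono_ae_restrict hab hf.intervalIntegrable_deriv (by simp)
          ?_
        rw [Filter.EventuallyLE, ae_restrict_iff' measurableSet_Icc]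
        have ha : ∀ᵐ t : ℝ, t ≠ a := by simp [ae_iff, measure_singleton]
        have hb : ∀ᵐ t : ℝ, t ≠ b := by simp [ae_iff, measure_singleton]
        filter_upwards [h, ha, hb] with t ht hta htb htI
        obtain ⟨v, hv, hd⟩ := ht ⟨lt_of_le_of_ne htI.1 (Ne.symm hta), lt_of_le_of_ne htI.2 htb⟩
        rwa [hd.deriv]
    _ = c * (b - a) := by simp [mul_comm]

theorem ae_differentiableAt_euclidean {n : ℕ} {f : ℝ → EuclideanSpace ℝ (Fin n)} {a b : ℝ}
    (hf : AbsolutelyContinuousOnInterval f a b) :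
    ∀ᵐ t, t ∈ uIcc a b → DifferentiableAt ℝ f t := by
  have h : ∀ i, ∀ᵐ t, t ∈ uIcc a b → DifferentiableAt ℝ (fun s => f s i) t := fun i =>
    (AbsolutelyContinuousOnInterval.locallyLipschitz_comp
      (f := fun x : EuclideanSpace ℝ (Fin n) => x i)
      (EuclideanSpace.proj (𝕜 := ℝ) i).lipschitz.locallyLipschitz hf
      hf.continuousOn).ae_differentiableAt
  filter_upwards [ae_all_iff.2 h] with t ht htI
  exact differentiableAt_euclidean.2 fun i => ht i htI

/-- Compare difference quotients and pass to the limit. No chain rule is available, since `f` itself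
need not be differentiable. -/
theorem norm_le_of_hasDerivAt_lipschitz_comp {E F : Type*} [NormedAddCommGroup E]
    [NormedSpace ℝ E] [NormedAddCommGroup F] [NormedSpace ℝ F] {f : E → F} {g : ℝ → E} {K : ℝ≥0}
    (hf : LipschitzWith K f) {v : E} {w : F} {t : ℝ} (hg : HasDerivAt g v t)
    (hw : HasDerivAt (fun s => f (g s)) w t) : ‖w‖ ≤ K * ‖v‖ := by
  refine le_of_tendsto_of_tendsto (hasDerivAt_iff_tendsto_slope.1 hw).norm
    ((hasDerivAt_iff_tendsto_slope.1 hg).norm.const_mul (K : ℝ)) (Eventually.of_forall fun s => ?_)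
  simp only [slope_def_module, norm_smul]
  have := hf.dist_le_mul (g s) (g t)
  rw [dist_eq_norm, dist_eq_norm] at this
  calc ‖(s - t)⁻¹‖ * ‖f (g s) - f (g t)‖ ≤ ‖(s - t)⁻¹‖ * (K * ‖g s - g t‖) := by gcongr
    _ = _ := by ring

/-! ### A Lyapunov criterion for global asymptotic stability -/

section Lyapunov

variable {X : Type*} [NormedAddCommGroup X] [NormedSpace ℝ X] {F : X → Set X} {C : Set X}
  {I : Set ℝ} {z : ℝ → X}

theorem IsSolution.Icc_subset (hz : IsSolution F C I z) {t : ℝ} (ht : t ∈ I) : Icc 0 t ⊆ I :=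
  hz.ordConnected.out hz.zero_mem ht

theorem IsSolution.sub_le_mul {U : X → ℝ} (hU : LocallyLipschitz U) {c : ℝ}
    (hz : IsSolution F C I z) {s t : ℝ} (hs : s ∈ I) (ht : t ∈ I) (hst : s ≤ t)
    (h : ∀ᵐ r, r ∈ Ioo s t → ∃ v ≤ c, HasDerivAt (fun r => U (z r)) v r) :
    U (z t) - U (z s) ≤ c * (t - s) := by
  have h0 : 0 ≤ s := hz.nonneg hs
  have hac : AbsolutelyContinuousOnInterval z s t := (hz.absCont t ht).mono (by
    rw [uIcc_of_le hst, uIcc_of_le (h0.trans hst)]; exact Icc_subset_Icc_left h0)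
  exact AbsolutelyContinuousOnInterval.sub_le_mul_of_hasDerivAt_le hst
    (AbsolutelyContinuousOnInterval.locallyLipschitz_comp hU hac hac.continuousOn) h

/-- `U` decreases along solutions at rate at least `D`. -/
def DecreasesAlong (F : X → Set X) (C : Set X) (U D : X → ℝ) : Prop :=
  ∀ (I : Set ℝ) (z : ℝ → X), IsSolution F C I z →
    ∀ᵐ t, t ∈ interior I → ∃ v ≤ -D (z t), HasDerivAt (fun r => U (z r)) v t

theorem DecreasesAlong.sub_le_mul {U D : X → ℝ} (hU : LocallyLipschitz U)
    (h : DecreasesAlong F C U D) (hz : IsSolution F C I z) {m : ℝ}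
    (hm : ∀ t ∈ I, m ≤ D (z t)) {s t : ℝ} (hs : s ∈ I) (ht : t ∈ I) (hst : s ≤ t) :
    U (z t) - U (z s) ≤ -m * (t - s) := by
  have hsub : Ioo s t ⊆ interior I := by
    rw [← interior_Icc]
    exact interior_mono (hz.ordConnected.out hs ht)
  refine hz.sub_le_mul hU hs ht hst ?_
  filter_upwards [h I z hz] with r hr hrI
  obtain ⟨v, hv, hd⟩ := hr (hsub hrI)
  exact ⟨v, hv.trans (neg_le_neg (hm r (interior_subset (hsub hrI)))), hd⟩

/-- A pair of functions certifying global asymptotic stability of a point: `V` is a weak Lyapunov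
function, proper and positive definite on `C`, and `W` decreases strictly away from the point. -/
theorem isGAS_singleton_of_lyapunov {zs : X} {V W D : X → ℝ}
    (hV : LocallyLipschitz V) (hW : LocallyLipschitz W) (hD : Continuous D)
    (hV0 : V zs = 0) (hVpos : ∀ x ∈ C, x ≠ zs → 0 < V x)
    (hVc : ∀ c, IsCompact {x | x ∈ C ∧ V x ≤ c})
    (hDpos : ∀ x ∈ C, x ≠ zs → 0 < D x)
    (hVdec : DecreasesAlong F C V 0) (hWdec : DecreasesAlong F C W D) :
    IsGAS F C {zs} := by
  have hVnn : ∀ x ∈ C, 0 ≤ V x := fun x hx => by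
    by_cases h : x = zs
    · rw [h, hV0]
    · exact (hVpos x hx h).le
  have hanti : ∀ (I : Set ℝ) (z : ℝ → X), IsSolution F C I z → ∀ s ∈ I, ∀ t ∈ I, s ≤ t →
      V (z t) ≤ V (z s) := fun I z hz s hs t ht hst => by
    have := hVdec.sub_le_mul hV hz (m := 0) (fun _ _ => le_rfl) hs ht hst
    linarith
  -- small values of `V` on `C` force closeness to `zs`
  have hsmall : ∀ ε > 0, ∃ c > 0, ∀ x ∈ C, V x < c → dist x zs < ε := by
    intro ε hε
    have hK : IsCompact ({x | x ∈ C ∧ V x ≤ 1} ∩ {x | ε ≤ dist x zs}) :=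
      (hVc 1).inter_right (isClosed_le continuous_const (by fun_prop))
    -- The threshold is the minimum of `V` over this compact set, capped at 1; the cap alone
    -- suffices if the set is empty.
    rcases ({x | x ∈ C ∧ V x ≤ 1} ∩ {x | ε ≤ dist x zs}).eq_empty_or_nonempty with he | hne
    · refine ⟨1, one_pos, fun x hx hVx => ?_⟩
      by_contra! hcon
      have : x ∈ ({x | x ∈ C ∧ V x ≤ 1} ∩ {x | ε ≤ dist x zs}) := ⟨⟨hx, hVx.le⟩, hcon⟩
      rw [he] at this
      exact this
    · obtain ⟨y, hy, hmin⟩ := hK.exists_isMinOn hne hV.continuous.continuousOn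
      have hyz : y ≠ zs := by
        rintro rfl
        have := hy.2
        simp only [mem_ofPred_eq, dist_self] at this
        linarith
      refine ⟨min 1 (V y), lt_min one_pos (hVpos y hy.1.1 hyz), fun x hx hVx => ?_⟩
      by_contra! hcon
      have := hmin (a := x) ⟨⟨hx, (hVx.trans_le (min_le_left _ _)).le⟩, hcon⟩
      exact absurd (hVx.trans_le (min_le_right _ _)) (not_lt.2 this)
  have hconv : ∀ (I : Set ℝ) (z : ℝ → X), IsSolution F C I z → BoundedAndConverges {zs} I z := by
    intro I z hz
    have hmem : ∀ t ∈ I, z t ∈ {x | x ∈ C ∧ V x ≤ V (z 0)} := fun t ht =>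
      ⟨hz.mem_constraint t ht, hanti I z hz 0 hz.zero_mem t ht (hz.nonneg ht)⟩
    refine ⟨(hVc _).isBounded.subset (image_subset_iff.2 hmem), fun hI => ?_⟩
    have hall : ∀ t, 0 ≤ t → t ∈ I := fun t ht => by
      obtain ⟨s, hs, hts⟩ := not_bddAbove_iff.1 hI t
      exact hz.Icc_subset hs ⟨ht, hts.le⟩
    -- If `V` stayed above `c`, the solution would remain in a compact set avoiding `zs`, where `D`
    -- has a positive minimum. Then `W` would fall linearly forever, although it is bounded below on
    -- that set; no sign condition on `W` is needed.
    have hreach : ∀ c > 0, ∃ t, 0 ≤ t ∧ V (z t) < c := by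
      intro c hc
      by_contra! hcon
      have hK : IsCompact ({x | x ∈ C ∧ V x ≤ V (z 0)} ∩ {x | c ≤ V x}) :=
        (hVc _).inter_right (isClosed_le continuous_const hV.continuous)
      have hzK : ∀ t ∈ I, z t ∈ ({x | x ∈ C ∧ V x ≤ V (z 0)} ∩ {x | c ≤ V x}) := fun t ht =>
        ⟨hmem t ht, hcon t (hz.nonneg ht)⟩
      have hne : ({x | x ∈ C ∧ V x ≤ V (z 0)} ∩ {x | c ≤ V x}).Nonempty :=
        ⟨_, hzK 0 hz.zero_mem⟩
      obtain ⟨y, hy, hmin⟩ := hK.exists_isMinOn hne hD.continuousOn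
      obtain ⟨x, -, hxmin⟩ := hK.exists_isMinOn hne hW.continuous.continuousOn
      have hm : 0 < D y := hDpos y hy.1.1 (by
        rintro rfl
        have := hy.2
        simp only [mem_ofPred_eq, hV0] at this
        linarith)
      -- By this time `W` must have dropped to at most its minimum `W x` minus 1.
      set T := (W (z 0) - W x + 1) / D y
      have hWx : W x ≤ W (z 0) := hxmin (hzK 0 hz.zero_mem)
      have hT : 0 ≤ T := div_nonneg (by linarith) hm.le
      have h1 := hWdec.sub_le_mul hW hz (fun t ht => hmin (hzK t ht)) hz.zero_mem (hall T hT) hT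
      have h2 : W x ≤ W (z T) := hxmin (hzK T (hall T hT))
      have h3 : D y * T = W (z 0) - W x + 1 := mul_div_cancel₀ _ hm.ne'
      linarith
    rw [Metric.tendsto_atTop]
    intro ε hε
    obtain ⟨c, hc, hcε⟩ := hsmall ε hε
    obtain ⟨T, hT, hVT⟩ := hreach c hc
    refine ⟨T, fun t ht => ?_⟩
    have htI := hall t (hT.trans ht)
    rw [Metric.infDist_singleton, Real.dist_0_eq_abs, abs_of_nonneg dist_nonneg]
    exact hcε _ (hz.mem_constraint t htI) ((hanti I z hz T (hall T hT) t htI ht).trans_lt hVT)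
  refine ⟨⟨fun ε hε => ?_, 1, one_pos, fun I z hz _ => hconv I z hz⟩,
    eq_univ_of_forall fun x I z hz _ => hconv I z hz⟩
  obtain ⟨c, hc, hcε⟩ := hsmall ε hε
  obtain ⟨δ, hδ, hball⟩ := Metric.continuous_iff.1 hV.continuous zs c hc
  refine ⟨δ / 2, by positivity, fun I z hz h0 t ht => ?_⟩
  rw [Metric.infDist_singleton] at h0 ⊢
  have h1 := hball (z 0) (by linarith)
  rw [hV0, Real.dist_0_eq_abs] at h1
  exact (hcε _ (hz.mem_constraint t ht) ((hanti I z hz 0 hz.zero_mem t ht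
    (hz.nonneg ht)).trans_lt ((le_abs_self _).trans_lt h1))).le

end Lyapunov

variable {n : ℕ}

/-! ### Regularity of the flow map -/

section Regularity

variable {G : SimpleGraph (Fin n)} [DecidableRel G.Adj] {Φ : EuclideanSpace ℝ (Fin n) → ℝ}
  {Klo Khi : ℝ}

theorem damping_subset_Icc (hK : Klo ≤ Khi) (z : State n) : damping G Φ Klo Khi z ⊆ Icc Klo Khi := by
  unfold damping
  split_ifs <;> simp [hK]

theorem damping_nonempty (hK : Klo ≤ Khi) (z : State n) : (damping G Φ Klo Khi z).Nonempty := by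
  unfold damping
  split_ifs <;> simp [hK]

theorem convex_damping (z : State n) : Convex ℝ (damping G Φ Klo Khi z) := by
  unfold damping
  split_ifs
  · exact convex_singleton _
  · exact convex_singleton _
  · exact convex_Icc _ _

theorem convex_flowMap (z : State n) : Convex ℝ (flowMap G Φ Klo Khi z) := by
  rintro _ ⟨k, hk, rfl⟩ _ ⟨l, hl, rfl⟩ a b ha hb hab
  refine ⟨a * k + b * l, convex_damping z hk hl ha hb hab, ?_⟩
  refine (WithLp.ofLp_injective 2) (Prod.ext ?_ ?_)
  · change z.snd = a • z.snd + b • z.snd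
    rw [← add_smul, hab, one_smul]
  · change -((a * k + b * l) • z.snd) - lapGrad G Φ z.fst =
      a • (-(k • z.snd) - lapGrad G Φ z.fst) + b • (-(l • z.snd) - lapGrad G Φ z.fst)
    have : lapGrad G Φ z.fst = (a + b) • lapGrad G Φ z.fst := by rw [hab, one_smul]
    conv_lhs => rw [this]
    module

theorem continuous_lapGrad (hΦ : Continuous (gradient Φ)) : Continuous (lapGrad G Φ) :=
  (LinearMap.continuous_of_finiteDimensional _).comp hΦ

theorem continuous_flow (hΦ : Continuous (gradient Φ)) :
    Continuous fun x : ℝ × State n =>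
      (WithLp.toLp 2 (x.2.snd, -(x.1 • x.2.snd) - lapGrad G Φ x.2.fst) : State n) := by
  have h := continuous_lapGrad (G := G) hΦ
  fun_prop

theorem locallyBoundedRel_flowMap (hK : Klo ≤ Khi) (hΦ : Continuous (gradient Φ))
    (C : Set (State n)) : LocallyBoundedRel (flowMap G Φ Klo Khi) C := by
  intro x _
  refine ⟨Metric.closedBall x 1, Metric.closedBall_mem_nhds x one_pos, ?_⟩
  refine ((isCompact_Icc (a := Klo) (b := Khi)).prod (isCompact_closedBall x 1)).image
    (continuous_flow (G := G) hΦ) |>.isBounded.subset ?_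
  refine iUnion₂_subset fun y hy => ?_
  rintro _ ⟨k, hk, rfl⟩
  exact ⟨(k, y), ⟨damping_subset_Icc hK y hk, hy.1⟩, rfl⟩

/-- The damping gains lie in a compact interval, so a subsequence converges. If the inner product is
nonzero at the limit point, its sign is eventually the same along the sequence and the gain is
eventually constant; if it is zero, every gain in the interval is admissible. -/
theorem outerSemicontinuous_flowMap (hK : Klo ≤ Khi) (hΦ : Continuous (gradient Φ)) :
    OuterSemicontinuous (flowMap G Φ Klo Khi) := by
  intro x y xs ys hx hy hmem
  choose k hk hkys using hmem
  obtain ⟨l, hl, φ, hφ, hkl⟩ :=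
    isCompact_Icc.tendsto_subseq fun i => damping_subset_Icc hK (xs i) (hk i)
  have hxφ := hx.comp hφ.tendsto_atTop
  have hinner : Continuous fun z : State n => inner ℝ (lapGrad G Φ z.fst) z.snd := by
    have h := continuous_lapGrad (G := G) hΦ
    fun_prop
  have hin := (hinner.tendsto x).comp hxφ
  refine ⟨l, ?_, ?_⟩
  · unfold damping
    split_ifs with h1 h2
    · have : ∀ᶠ i in atTop, Khi = (k ∘ φ) i := by
        filter_upwards [hin.eventually (lt_mem_nhds h1)] with i hi
        have := hk (φ i)
        simp only [Function.comp_apply] at hi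
        unfold damping at this
        rw [if_pos hi] at this
        exact this.symm
      exact tendsto_nhds_unique hkl (tendsto_const_nhds.congr' this)
    · have : ∀ᶠ i in atTop, Klo = (k ∘ φ) i := by
        filter_upwards [hin.eventually (gt_mem_nhds h2)] with i hi
        have := hk (φ i)
        simp only [Function.comp_apply] at hi
        unfold damping at this
        rw [if_neg (not_lt.2 hi.le), if_pos hi] at this
        exact this.symm
      exact tendsto_nhds_unique hkl (tendsto_const_nhds.congr' this)
    · exact hl
  · refine tendsto_nhds_unique
      (((continuous_flow (G := G) hΦ).tendsto (l, x)).comp (hkl.prodMk_nhds hxφ)) ?_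
    refine (hy.comp hφ.tendsto_atTop).congr fun i => ?_
    exact (hkys (φ i)).symm

theorem isClosed_feasible (d : ℝ) : IsClosed (feasible n d) :=
  isClosed_eq (by fun_prop) continuous_const

theorem isClosed_flowSet (d : ℝ) : IsClosed (flowSet n d) :=
  ((isClosed_feasible d).preimage (by fun_prop)).inter
    ((isClosed_feasible 0).preimage (by fun_prop))

end Regularity

/-! ### The Laplacian and its inverse on the vectors of zero sum -/

section Laplacian

variable (G : SimpleGraph (Fin n)) [DecidableRel G.Adj]

theorem isSymmetric_lap : (Matrix.toEuclideanLin (G.lapMatrix ℝ)).IsSymmetric :=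
  Matrix.isSymmetric_toEuclideanLin_iff.2 (G.isHermitian_lapMatrix ℝ)

theorem inner_lap_nonneg (x : EuclideanSpace ℝ (Fin n)) :
    0 ≤ inner ℝ (Matrix.toEuclideanLin (G.lapMatrix ℝ) x) x := by
  have := (G.posSemidef_lapMatrix ℝ).dotProduct_mulVec_nonneg x.ofLp
  simpa [EuclideanSpace.inner_eq_star_dotProduct] using this

variable {G}

theorem eq_of_lap_eq_zero (hG : G.Connected) {x : EuclideanSpace ℝ (Fin n)}
    (hx : Matrix.toEuclideanLin (G.lapMatrix ℝ) x = 0) (i j : Fin n) : x i = x j := by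
  refine G.lapMatrix_mulVec_eq_zero_iff_forall_reachable.1 ?_ i j (hG.preconnected i j)
  simpa using congrArg WithLp.ofLp hx

theorem lap_eq_zero_of_inner_eq_zero {x : EuclideanSpace ℝ (Fin n)}
    (hx : inner ℝ (Matrix.toEuclideanLin (G.lapMatrix ℝ) x) x = 0) :
    Matrix.toEuclideanLin (G.lapMatrix ℝ) x = 0 := by
  have h := ((G.posSemidef_lapMatrix ℝ).dotProduct_mulVec_zero_iff x.ofLp).1 (by
    simpa [EuclideanSpace.inner_eq_star_dotProduct] using hx)
  ext i
  simpa using congrFun h i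

theorem sum_eq_inner (x : EuclideanSpace ℝ (Fin n)) :
    ∑ i, x i = inner ℝ (WithLp.toLp 2 (fun _ => (1 : ℝ))) x := by
  simp [PiLp.inner_apply]

theorem lap_one : Matrix.toEuclideanLin (G.lapMatrix ℝ) (WithLp.toLp 2 (fun _ => (1 : ℝ))) = 0 := by
  ext i
  simpa using congrFun (G.lapMatrix_mulVec_const_eq_zero (R := ℝ)) i

/-- On vectors of zero sum the Laplacian of a connected graph has a symmetric positive definite
right inverse. -/
theorem exists_lap_inverse (hG : G.Connected) :
    ∃ A : EuclideanSpace ℝ (Fin n) →L[ℝ] EuclideanSpace ℝ (Fin n),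
      (∀ x y, inner ℝ (A x) y = inner ℝ x (A y)) ∧
      (∃ a > 0, ∀ x, a * ‖x‖ ^ 2 ≤ inner ℝ (A x) x) ∧
      ∀ g p, p ∈ feasible n 0 →
        inner ℝ (A p) (Matrix.toEuclideanLin (G.lapMatrix ℝ) g) = inner ℝ g p := by
  set T := Matrix.toEuclideanLin (G.lapMatrix ℝ) with hT
  set u : EuclideanSpace ℝ (Fin n) := WithLp.toLp 2 (fun _ => (1 : ℝ)) with hu
  have hTs : T.IsSymmetric := isSymmetric_lap G
  -- The rank-one term `u uᵀ` is positive on the kernel of the Laplacian, the span of `u`, and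
  -- vanishes on zero-sum vectors. So `S` is positive definite on the whole space, and `A` is its
  -- inverse.
  let S : EuclideanSpace ℝ (Fin n) →ₗ[ℝ] EuclideanSpace ℝ (Fin n) :=
    T + ((innerSL ℝ u).smulRight u : EuclideanSpace ℝ (Fin n) →L[ℝ] EuclideanSpace ℝ (Fin n))
  have hS : ∀ x, S x = T x + inner ℝ u x • u := fun x => rfl
  have hSs : ∀ x y, inner ℝ (S x) y = inner ℝ x (S y) := fun x y => by
    rw [hS, hS, inner_add_left, inner_add_right, hTs x y, inner_smul_left, inner_smul_right,
      real_inner_comm u x]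
    simp [mul_comm]
  have hSpos : ∀ x, x ≠ 0 → 0 < inner ℝ (S x) x := fun x hx => by
    have h1 : inner ℝ (S x) x = inner ℝ (T x) x + inner ℝ u x ^ 2 := by
      rw [hS, inner_add_left, inner_smul_left]
      simp [sq]
    rw [h1]
    have h2 := inner_lap_nonneg G x
    refine lt_of_le_of_ne (add_nonneg h2 (sq_nonneg _)) fun h0 => hx ?_
    have h3 : inner ℝ u x ^ 2 = 0 := by nlinarith [sq_nonneg (inner ℝ u x)]
    have h4 : T x = 0 := lap_eq_zero_of_inner_eq_zero (by rw [← hT]; linarith)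
    have h5 := eq_of_lap_eq_zero hG h4
    have h6 : ∑ i, x i = 0 := by rw [sum_eq_inner]; exact pow_eq_zero_iff two_ne_zero |>.1 h3
    ext i
    have hn : (n : ℝ) ≠ 0 := by
      have := i.pos
      positivity
    rw [Finset.sum_congr rfl fun j _ => h5 j i] at h6
    simpa [hn] using h6
  have hinj : Function.Injective S := by
    refine (injective_iff_map_eq_zero S).2 fun x hx => ?_
    by_contra hne
    have := hSpos x hne
    rw [hx, inner_zero_left] at this
    exact lt_irrefl _ this
  let e := LinearEquiv.ofInjectiveEndo S hinj
  have he : ∀ x, S (e.symm x) = x := fun x => e.apply_symm_apply x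
  let A : EuclideanSpace ℝ (Fin n) →L[ℝ] EuclideanSpace ℝ (Fin n) :=
    LinearMap.toContinuousLinearMap (e.symm : EuclideanSpace ℝ (Fin n) →ₗ[ℝ] _)
  have hSA : ∀ x, S (A x) = x := he
  have hApos : ∀ x, x ≠ 0 → 0 < inner ℝ (A x) x := fun x hx => by
    have h0 : A x ≠ 0 := fun h => hx (by rw [← hSA x, h, map_zero])
    have := hSpos (A x) h0
    rwa [hSA, real_inner_comm] at this
  refine ⟨A, fun x y => ?_, ?_, fun g p hp => ?_⟩
  · conv_lhs => rw [← hSA y]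
    rw [← hSs, hSA]
  -- The constant `a` is the minimum of the quadratic form on the unit sphere; an empty sphere means
  -- a trivial space.
  · rcases (Metric.sphere (0 : EuclideanSpace ℝ (Fin n)) 1).eq_empty_or_nonempty with hemp | hne
    · refine ⟨1, one_pos, fun x => ?_⟩
      have hx : x = 0 := by
        by_contra hx
        have : (‖x‖⁻¹ : ℝ) • x ∈ Metric.sphere (0 : EuclideanSpace ℝ (Fin n)) 1 := by
          simp [norm_smul, hx]
        rw [hemp] at this
        exact this
      simp [hx]
    · have hcont : Continuous fun x : EuclideanSpace ℝ (Fin n) => inner ℝ (A x) x := by fun_prop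
      obtain ⟨y, hy, hmin⟩ := (isCompact_sphere (0 : EuclideanSpace ℝ (Fin n)) 1).exists_isMinOn
        hne hcont.continuousOn
      refine ⟨inner ℝ (A y) y, hApos y (by rintro rfl; simp at hy), fun x => ?_⟩
      by_cases hx : x = 0
      · simp [hx]
      have hx' : 0 < ‖x‖ := norm_pos_iff.2 hx
      have h1 : inner ℝ (A y) y ≤ inner ℝ (A ((‖x‖⁻¹ : ℝ) • x)) ((‖x‖⁻¹ : ℝ) • x) :=
        hmin (by simp [norm_smul, hx])
      rw [map_smul, inner_smul_left, inner_smul_right] at h1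
      simp only [conj_trivial] at h1
      calc inner ℝ (A y) y * ‖x‖ ^ 2
          ≤ (‖x‖⁻¹ * (‖x‖⁻¹ * inner ℝ (A x) x)) * ‖x‖ ^ 2 := by gcongr
        _ = inner ℝ (A x) x := by field_simp
  · have hTu : T u = 0 := lap_one
    have hn : inner ℝ u u ≠ 0 := by
      have : Nonempty (Fin n) := hG.nonempty
      have hn : (n : ℝ) ≠ 0 := by
        have := (Classical.arbitrary (Fin n)).pos
        positivity
      rw [← sum_eq_inner]
      simpa [hu] using hn
    -- Pairing `S (A p) = p` with `u` shows that `A p` has zero sum, so the rank-one term drops out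
    -- and `T (A p) = p`.
    have h1 : inner ℝ u (S (A p)) = 0 := by
      rw [hSA, ← sum_eq_inner]
      exact hp
    rw [hS, inner_add_right, ← hTs, hTu, inner_zero_left, zero_add, inner_smul_right] at h1
    have h2 : inner ℝ u (A p) = 0 := (mul_eq_zero.1 h1).resolve_right hn
    have h3 : T (A p) = p := by
      have := hSA p
      rwa [hS, h2, zero_smul, add_zero] at this
    rw [← hTs, h3, real_inner_comm]

end Laplacian

/-! ### Minimizers of a convex objective -/

section Minimizer

variable {Φ : EuclideanSpace ℝ (Fin n) → ℝ} {d : ℝ} {q : EuclideanSpace ℝ (Fin n)}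

/-- Restrict to the segment from `x` to `y`: a convex function of one variable has derivative at 0
at most its slope over [0, 1]. -/
theorem add_inner_gradient_le {E : Type*} [NormedAddCommGroup E] [InnerProductSpace ℝ E]
    [CompleteSpace E] {f : E → ℝ} (hf : ConvexOn ℝ univ f) {x : E} (hd : DifferentiableAt ℝ f x)
    (y : E) : f x + inner ℝ (gradient f x) (y - x) ≤ f y := by
  have hc : ConvexOn ℝ univ (f ∘ AffineMap.lineMap (k := ℝ) x y) := by
    simpa using hf.comp_affineMap (AffineMap.lineMap (k := ℝ) x y)
  have hl : HasDerivAt (AffineMap.lineMap (k := ℝ) x y) (y - x) (0 : ℝ) :=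
    AffineMap.hasDerivAt_lineMap
  have hg : HasDerivAt (f ∘ AffineMap.lineMap (k := ℝ) x y) (inner ℝ (gradient f x) (y - x))
      (0 : ℝ) := by
    have hd' : HasFDerivAt f (fderiv ℝ f x) (AffineMap.lineMap (k := ℝ) x y (0 : ℝ)) := by
      simpa using hd.hasFDerivAt
    rw [inner_gradient_left]
    exact hd'.comp_hasDerivAt 0 hl
  have := hc.le_slope_of_hasDerivAt (mem_univ 0) (mem_univ 1) one_pos hg
  simp only [slope_def_field, Function.comp_apply, AffineMap.lineMap_apply_one,
    AffineMap.lineMap_apply_zero, sub_zero, div_one] at this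
  linarith

theorem IsMinimizer.lt_of_ne (hu : ∃! q, IsMinimizer Φ d q) (hq : IsMinimizer Φ d q)
    {w : EuclideanSpace ℝ (Fin n)} (hw : w ∈ feasible n d) (hne : w ≠ q) : Φ q < Φ w := by
  refine lt_of_le_of_ne (hq.2 w hw) fun h => hne (hu.unique ⟨hw, fun v hv => ?_⟩ hq)
  rw [← h]
  exact hq.2 v hv

/-- On a connected graph the gradient is then a multiple of 𝟙, hence orthogonal to every difference
of feasible points; the tangent inequality for convex functions concludes. -/
theorem isMinimizer_of_lapGrad_eq_zero {G : SimpleGraph (Fin n)} [DecidableRel G.Adj]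
    (hG : G.Connected) (hΦ : ObjectiveConditions Φ) (hq : q ∈ feasible n d)
    (h : lapGrad G Φ q = 0) : IsMinimizer Φ d q := by
  refine ⟨hq, fun w hw => ?_⟩
  obtain ⟨i⟩ := hG.nonempty
  have hconst := eq_of_lap_eq_zero hG h
  have h0 : inner ℝ (gradient Φ q) (w - q) = 0 := by
    have h1 : inner ℝ (gradient Φ q) (w - q) = ∑ j, (gradient Φ q) i * (w j - q j) := by
      rw [PiLp.inner_apply]
      refine Finset.sum_congr rfl fun j _ => ?_
      rw [hconst i j]
      simp [mul_comm]
    have hq' : ∑ j, q j = d := hq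
    have hw' : ∑ j, w j = d := hw
    rw [h1, ← Finset.mul_sum, Finset.sum_sub_distrib, hq', hw', sub_self, mul_zero]
  have := add_inner_gradient_le hΦ.convex
    (hΦ.contDiff.differentiable one_ne_zero).differentiableAt (x := q) w
  linarith

end Minimizer

/-! ### The Lyapunov functions -/

section LyapunovFunctions

/-- The energy `Φ(q) - Φ(q*) + ½ ⟪A p, p⟫`, plus the cross term `ε ⟪p, ℒ∇Φ(q)⟫`. -/
def energy (G : SimpleGraph (Fin n)) [DecidableRel G.Adj] (Φ : EuclideanSpace ℝ (Fin n) → ℝ)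
    (A : EuclideanSpace ℝ (Fin n) →L[ℝ] EuclideanSpace ℝ (Fin n)) (q : EuclideanSpace ℝ (Fin n))
    (ε : ℝ) (z : State n) : ℝ :=
  Φ z.fst - Φ q + 1 / 2 * inner ℝ (A z.snd) z.snd + ε * inner ℝ z.snd (lapGrad G Φ z.fst)

variable {G : SimpleGraph (Fin n)} [DecidableRel G.Adj] {Φ : EuclideanSpace ℝ (Fin n) → ℝ}
  {A : EuclideanSpace ℝ (Fin n) →L[ℝ] EuclideanSpace ℝ (Fin n)} {Klo Khi d ε a : ℝ}
  {q : EuclideanSpace ℝ (Fin n)}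

theorem exists_lipschitzWith_lapGrad (hΦ : ObjectiveConditions Φ) :
    ∃ L : ℝ≥0, LipschitzWith L (lapGrad G Φ) := by
  obtain ⟨L, hL⟩ := hΦ.lipschitz_gradient
  exact ⟨_, (LinearMap.toContinuousLinearMap
    (Matrix.toEuclideanLin (G.lapMatrix ℝ))).lipschitz.comp hL⟩

theorem ObjectiveConditions.continuous_gradient (hΦ : ObjectiveConditions Φ) :
    Continuous (gradient Φ) := by
  obtain ⟨L, hL⟩ := hΦ.lipschitz_gradient
  exact hL.continuous

/-- The energy is a C¹ function of the triple (q, p, ℒ∇Φ(q)), whose last entry is only Lipschitz in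
q. -/
theorem locallyLipschitz_energy (hΦ : ObjectiveConditions Φ) :
    LocallyLipschitz (energy G Φ A q ε) := by
  obtain ⟨L, hL⟩ := exists_lipschitzWith_lapGrad (G := G) hΦ
  have hΦc := hΦ.contDiff
  let f : EuclideanSpace ℝ (Fin n) × EuclideanSpace ℝ (Fin n) × EuclideanSpace ℝ (Fin n) → ℝ :=
    fun x => Φ x.1 - Φ q + 1 / 2 * inner ℝ (A x.2.1) x.2.1 + ε * inner ℝ x.2.1 x.2.2
  have hf : ContDiff ℝ 1 f := by
    have h1 : ContDiff ℝ 1 fun x : EuclideanSpace ℝ (Fin n) × EuclideanSpace ℝ (Fin n) ×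
      EuclideanSpace ℝ (Fin n) => Φ x.1 := hΦc.comp contDiff_fst
    have h2 : ContDiff ℝ 1 fun x : EuclideanSpace ℝ (Fin n) × EuclideanSpace ℝ (Fin n) ×
      EuclideanSpace ℝ (Fin n) => A x.2.1 := A.contDiff.comp (by fun_prop)
    have h3 : ContDiff ℝ 1 fun x : EuclideanSpace ℝ (Fin n) × EuclideanSpace ℝ (Fin n) ×
      EuclideanSpace ℝ (Fin n) => x.2.1 := by fun_prop
    have h4 : ContDiff ℝ 1 fun x : EuclideanSpace ℝ (Fin n) × EuclideanSpace ℝ (Fin n) ×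
      EuclideanSpace ℝ (Fin n) => x.2.2 := by fun_prop
    exact ((h1.sub contDiff_const).add (contDiff_const.mul (h2.inner ℝ h3))).add
      (contDiff_const.mul (h3.inner ℝ h4))
  have hfst : LocallyLipschitz fun z : State n => z.fst :=
    (WithLp.fstL 2 ℝ (EuclideanSpace ℝ (Fin n))
      (EuclideanSpace ℝ (Fin n))).lipschitz.locallyLipschitz
  have hsnd : LocallyLipschitz fun z : State n => z.snd :=
    (WithLp.sndL 2 ℝ (EuclideanSpace ℝ (Fin n))
      (EuclideanSpace ℝ (Fin n))).lipschitz.locallyLipschitz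
  exact hf.locallyLipschitz.comp (hfst.prodMk (hsnd.prodMk (hL.locallyLipschitz.comp hfst)))

/-- The derivative of the energy along a solution. -/
theorem ae_hasDerivAt_energy (hΦ : ObjectiveConditions Φ) {L : ℝ≥0}
    (hL : LipschitzWith L (lapGrad G Φ)) (hK : Klo ≤ Khi)
    (hAs : ∀ x y, inner ℝ (A x) y = inner ℝ x (A y))
    (hA : ∀ g p, p ∈ feasible n 0 →
      inner ℝ (A p) (Matrix.toEuclideanLin (G.lapMatrix ℝ) g) = inner ℝ g p)
    {I : Set ℝ} {z : ℝ → State n}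
    (hz : IsSolution (flowMap G Φ Klo Khi) (flowSet n d) I z) :
    ∀ᵐ t, t ∈ interior I → ∃ k ∈ Icc Klo Khi, ∃ w : EuclideanSpace ℝ (Fin n),
      ‖w‖ ≤ L * ‖(z t).snd‖ ∧
      HasDerivAt (fun r => energy G Φ A q ε (z r))
        (-(k * inner ℝ (A (z t).snd) (z t).snd) +
          ε * (inner ℝ (z t).snd w - k * inner ℝ (z t).snd (lapGrad G Φ (z t).fst) -
            ‖lapGrad G Φ (z t).fst‖ ^ 2)) t := by
  have hdiff : ∀ᵐ t, t ∈ interior I → DifferentiableAt ℝ (fun r => lapGrad G Φ (z r).fst) t := by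
    have hfst : LocallyLipschitz fun z : State n => z.fst :=
      (WithLp.fstL 2 ℝ (EuclideanSpace ℝ (Fin n))
        (EuclideanSpace ℝ (Fin n))).lipschitz.locallyLipschitz
    -- Rational end points keep the exceptional null sets countable in number; every interior time
    -- lies below a rational element of `I`.
    have hN : ∀ N : ℚ, ∀ᵐ t, (N : ℝ) ∈ I → t ∈ uIcc (0 : ℝ) N →
        DifferentiableAt ℝ (fun r => lapGrad G Φ (z r).fst) t := fun N => by
      by_cases h : (N : ℝ) ∈ I
      · have hac := hz.absCont N h
        filter_upwards [ae_differentiableAt_euclidean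
          (AbsolutelyContinuousOnInterval.locallyLipschitz_comp
            (hL.locallyLipschitz.comp hfst) hac hac.continuousOn)] with t ht _
        exact ht
      · exact Eventually.of_forall fun t ht => absurd ht h
    filter_upwards [ae_all_iff.2 hN] with t ht htI
    obtain ⟨s, hts, hs⟩ := exists_Ico_subset_of_mem_nhds (mem_interior_iff_mem_nhds.1 htI)
      (exists_gt t)
    obtain ⟨N, htN, hNs⟩ := exists_rat_btwn hts
    have h0 : 0 ≤ t := hz.nonneg (interior_subset htI)
    refine ht N (hs ⟨htN.le, hNs⟩) ?_
    rw [uIcc_of_le (h0.trans htN.le)]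
    exact ⟨h0, htN.le⟩
  filter_upwards [hdiff, hz.deriv_mem] with t hht hzt htI
  have hw := (hht htI).hasDerivAt
  set w := deriv (fun r => lapGrad G Φ (z r).fst) t
  obtain ⟨v, ⟨k, hk, rfl⟩, hd⟩ := hzt htI
  have hq : HasDerivAt (fun r => (z r).fst) (z t).snd t :=
    (WithLp.fstL 2 ℝ (EuclideanSpace ℝ (Fin n))
      (EuclideanSpace ℝ (Fin n))).hasFDerivAt.comp_hasDerivAt t hd
  have hp : HasDerivAt (fun r => (z r).snd) (-(k • (z t).snd) - lapGrad G Φ (z t).fst) t :=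
    (WithLp.sndL 2 ℝ (EuclideanSpace ℝ (Fin n))
      (EuclideanSpace ℝ (Fin n))).hasFDerivAt.comp_hasDerivAt t hd
  refine ⟨k, damping_subset_Icc hK _ hk, w, norm_le_of_hasDerivAt_lipschitz_comp hL hq hw, ?_⟩
  have hΦd : HasDerivAt (fun r => Φ (z r).fst) (inner ℝ (gradient Φ (z t).fst) (z t).snd) t := by
    rw [inner_gradient_left]
    exact (hΦ.contDiff.differentiable one_ne_zero).differentiableAt.hasFDerivAt.comp_hasDerivAt t hq
  have hAp : HasDerivAt (fun r => A (z r).snd) (A (-(k • (z t).snd) - lapGrad G Φ (z t).fst)) t :=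
    A.hasFDerivAt.comp_hasDerivAt t hp
  have h := ((hΦd.sub_const (Φ q)).add ((hAp.inner ℝ hp).const_mul (1 / 2))).add
    ((hp.inner ℝ hw).const_mul ε)
  refine h.congr_deriv ?_
  -- This identity cancels the power ⟪∇Φ, p⟫ against the Laplacian force in the kinetic term.
  have hkey := hA (gradient Φ (z t).fst) (z t).snd (hz.mem_constraint t (interior_subset htI)).2
  change inner ℝ (A (z t).snd) (lapGrad G Φ (z t).fst) = _ at hkey
  rw [hAs (-(k • (z t).snd) - lapGrad G Φ (z t).fst),
    real_inner_comm (A (z t).snd) (-(k • (z t).snd) - lapGrad G Φ (z t).fst)]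
  simp only [inner_sub_left, inner_sub_right, inner_neg_left, inner_neg_right, inner_smul_left,
    inner_smul_right, hkey, real_inner_self_eq_norm_sq, conj_trivial]
  ring

theorem decreasesAlong_energy_zero (hΦ : ObjectiveConditions Φ) (hKlo : 0 < Klo) (hK : Klo ≤ Khi)
    (hAs : ∀ x y, inner ℝ (A x) y = inner ℝ x (A y))
    (ha : 0 < a) (hAa : ∀ x, a * ‖x‖ ^ 2 ≤ inner ℝ (A x) x)
    (hA : ∀ g p, p ∈ feasible n 0 →
      inner ℝ (A p) (Matrix.toEuclideanLin (G.lapMatrix ℝ) g) = inner ℝ g p) :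
    DecreasesAlong (flowMap G Φ Klo Khi) (flowSet n d) (energy G Φ A q 0) 0 := by
  intro I z hz
  obtain ⟨L, hL⟩ := exists_lipschitzWith_lapGrad (G := G) hΦ
  filter_upwards [ae_hasDerivAt_energy (q := q) (ε := 0) hΦ hL hK hAs hA hz] with t ht htI
  obtain ⟨k, hk, w, -, hd⟩ := ht htI
  refine ⟨_, ?_, hd⟩
  have h1 : 0 ≤ inner ℝ (A (z t).snd) (z t).snd := le_trans (by positivity) (hAa _)
  have h2 : 0 ≤ k * inner ℝ (A (z t).snd) (z t).snd := mul_nonneg (hKlo.le.trans hk.1) h1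
  simp only [Pi.zero_apply, zero_mul]
  linarith

theorem decreasesAlong_energy (hΦ : ObjectiveConditions Φ) {L : ℝ≥0}
    (hL : LipschitzWith L (lapGrad G Φ)) (hKlo : 0 < Klo) (hK : Klo ≤ Khi)
    (hAs : ∀ x y, inner ℝ (A x) y = inner ℝ x (A y))
    (ha : 0 < a) (hAa : ∀ x, a * ‖x‖ ^ 2 ≤ inner ℝ (A x) x)
    (hA : ∀ g p, p ∈ feasible n 0 →
      inner ℝ (A p) (Matrix.toEuclideanLin (G.lapMatrix ℝ) g) = inner ℝ g p)
    (hε : 0 ≤ ε) (hεL : ε * (2 * L + Khi ^ 2) ≤ Klo * a) :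
    DecreasesAlong (flowMap G Φ Klo Khi) (flowSet n d) (energy G Φ A q ε)
      (fun x => Klo * a / 2 * ‖x.snd‖ ^ 2 + ε / 2 * ‖lapGrad G Φ x.fst‖ ^ 2) := by
  intro I z hz
  filter_upwards [ae_hasDerivAt_energy (q := q) (ε := ε) hΦ hL hK hAs hA hz] with t ht htI
  obtain ⟨k, hk, w, hw, hd⟩ := ht htI
  refine ⟨_, ?_, hd⟩
  set p := (z t).snd
  set h := lapGrad G Φ (z t).fst
  have hk0 : 0 ≤ k := hKlo.le.trans hk.1
  have h1 : Klo * (a * ‖p‖ ^ 2) ≤ k * inner ℝ (A p) p :=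
    mul_le_mul hk.1 (hAa p) (by positivity) hk0
  have h2 : inner ℝ p w ≤ L * ‖p‖ ^ 2 := by
    calc inner ℝ p w ≤ ‖p‖ * ‖w‖ := real_inner_le_norm _ _
      _ ≤ ‖p‖ * (L * ‖p‖) := by gcongr
      _ = L * ‖p‖ ^ 2 := by ring
  -- Young's inequality, weighted so that only half of the gain `‖h‖ ^ 2` is spent.
  have h3 : -(k * inner ℝ p h) ≤ Khi ^ 2 / 2 * ‖p‖ ^ 2 + ‖h‖ ^ 2 / 2 := by
    have h4 : -(k * inner ℝ p h) ≤ k * (‖p‖ * ‖h‖) := by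
      have := mul_le_mul_of_nonneg_left (neg_le_of_abs_le (abs_real_inner_le_norm p h)) hk0
      linarith
    have h5 : k * (‖p‖ * ‖h‖) ≤ Khi * (‖p‖ * ‖h‖) := by
      gcongr
      exact hk.2
    nlinarith [sq_nonneg (Khi * ‖p‖ - ‖h‖)]
  have h6 : ε * (inner ℝ p w - k * inner ℝ p h - ‖h‖ ^ 2) ≤
      ε * (L * ‖p‖ ^ 2 + (Khi ^ 2 / 2 * ‖p‖ ^ 2 + ‖h‖ ^ 2 / 2) - ‖h‖ ^ 2) :=
    mul_le_mul_of_nonneg_left (by linarith) hε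
  -- The choice of `ε` makes the cross term cost at most half of the dissipation `Klo * a * ‖p‖ ^
  -- 2`.
  have h7 := mul_le_mul_of_nonneg_right hεL (sq_nonneg ‖p‖)
  linarith

theorem isCompact_energy_sublevel (hΦ : ObjectiveConditions Φ) (hq : IsMinimizer Φ d q)
    (ha : 0 < a) (hAa : ∀ x, a * ‖x‖ ^ 2 ≤ inner ℝ (A x) x) (c : ℝ) :
    IsCompact {x | x ∈ flowSet n d ∧ energy G Φ A q 0 x ≤ c} := by
  -- Both parts of the energy are nonnegative on the flow set, so each is at most `c`; the lower
  -- bound on `A` turns the kinetic part into this radius for `p`.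
  have hK := ((hΦ.compact_sublevel (c + Φ q)).prod
    (isCompact_closedBall (0 : EuclideanSpace ℝ (Fin n)) (√(2 * c / a)))).image
    (WithLp.prod_continuous_toLp 2 _ _)
  refine hK.of_isClosed_subset ((isClosed_flowSet d).inter
    (isClosed_le (locallyLipschitz_energy hΦ).continuous continuous_const)) ?_
  rintro x ⟨hx, hxc⟩
  refine ⟨(x.fst, x.snd), ⟨?_, ?_⟩, rfl⟩
  all_goals
    have h1 := hq.2 x.fst hx.1
    have h2 := hAa x.snd
    have h3 : 0 ≤ a * ‖x.snd‖ ^ 2 := by positivity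
    simp only [energy, zero_mul, add_zero] at hxc
  · change Φ x.fst ≤ c + Φ q
    linarith
  · rw [mem_closedBall_zero_iff]
    refine Real.le_sqrt_of_sq_le ?_
    rw [le_div_iff₀ ha]
    linarith

/-- Global asymptotic stability of the minimizer at rest for a single objective. -/
theorem isGAS_flowMap (hG : G.Connected) (hΦ : ObjectiveConditions Φ)
    (hu : ∃! q, IsMinimizer Φ d q) (hq : IsMinimizer Φ d q) (hKlo : 0 < Klo) (hK : Klo ≤ Khi) :
    IsGAS (flowMap G Φ Klo Khi) (flowSet n d) {WithLp.toLp 2 (q, 0)} := by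
  obtain ⟨A, hAs, ⟨a, ha, hAa⟩, hA⟩ := exists_lap_inverse hG
  obtain ⟨L, hL⟩ := exists_lipschitzWith_lapGrad (G := G) hΦ
  set ε := Klo * a / (2 * L + Khi ^ 2) with hεdef
  have hKhi : 0 < Khi := hKlo.trans_le hK
  have hden : 0 < 2 * (L : ℝ) + Khi ^ 2 := by positivity
  have hε : 0 < ε := by positivity
  have hεL : ε * (2 * L + Khi ^ 2) ≤ Klo * a := (div_mul_cancel₀ _ hden.ne').le
  have hsplit : ∀ x : State n, x ≠ WithLp.toLp 2 (q, 0) → x.snd = 0 → x.fst ≠ q :=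
    fun x hx h0 hxq => hx ((WithLp.ofLp_injective 2) (Prod.ext hxq h0))
  have hcont := continuous_lapGrad (G := G) hΦ.continuous_gradient
  refine isGAS_singleton_of_lyapunov (V := energy G Φ A q 0) (W := energy G Φ A q ε)
    (D := fun x => Klo * a / 2 * ‖x.snd‖ ^ 2 + ε / 2 * ‖lapGrad G Φ x.fst‖ ^ 2)
    (locallyLipschitz_energy hΦ) (locallyLipschitz_energy hΦ) (by fun_prop) (by simp [energy])
    (fun x hx hne => ?_) (isCompact_energy_sublevel hΦ hq ha hAa) (fun x hx hne => ?_)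
    (decreasesAlong_energy_zero hΦ hKlo hK hAs ha hAa hA)
    (decreasesAlong_energy hΦ hL hKlo hK hAs ha hAa hA hε.le hεL)
  · have h1 := hq.2 x.fst hx.1
    have h2 := hAa x.snd
    simp only [energy, zero_mul, add_zero]
    by_cases h0 : x.snd = 0
    · have := hq.lt_of_ne hu hx.1 (hsplit x hne h0)
      simp only [h0, inner_zero_right]
      linarith
    · have : 0 < a * ‖x.snd‖ ^ 2 := by
        have := norm_pos_iff.2 h0
        positivity
      linarith
  · by_cases h0 : x.snd = 0
    · have h1 : lapGrad G Φ x.fst ≠ 0 := fun h =>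
        hsplit x hne h0 (hu.unique (isMinimizer_of_lapGrad_eq_zero hG hΦ hx.1 h) hq)
      have := norm_pos_iff.2 h1
      positivity
    · have := norm_pos_iff.2 h0
      positivity

end LyapunovFunctions

end HiHBM

end

theorem mainTheorem5 {n M : ℕ} (G : SimpleGraph (Fin n)) [DecidableRel G.Adj] (hG : G.Connected)
    (d Klo Khi : ℝ) (hKlo : 0 < Klo) (hK : Klo ≤ Khi)
    (φ : Fin M → Fin n → ℝ → ℝ)
    (hφ : HiHBM.SwitchedObjectiveConditions (fun σ => HiHBM.objective (φ σ)) d)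
    (qs : Fin M → EuclideanSpace ℝ (Fin n))
    (hqs : ∀ σ, HiHBM.IsMinimizer (HiHBM.objective (φ σ)) d (qs σ)) :
    HiHBM.RegularAndGAS (fun σ => HiHBM.flowMap G (HiHBM.objective (φ σ)) Klo Khi)
      (HiHBM.flowSet n d) (fun σ => WithLp.toLp 2 (qs σ, 0)) := by
  have hcont : ∀ σ, Continuous (gradient (HiHBM.objective (φ σ))) := fun σ =>
    (hφ σ).1.continuous_gradient
  exact
    { outerSemicontinuous := fun σ => HiHBM.outerSemicontinuous_flowMap hK (hcont σ)
      locallyBounded := fun σ => HiHBM.locallyBoundedRel_flowMap hK (hcont σ) _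
      nonempty := fun σ z _ => (HiHBM.damping_nonempty hK z).image _
      convex := fun σ z _ => HiHBM.convex_flowMap z
      gas := fun σ => HiHBM.isGAS_flowMap hG (hφ σ).1 (hφ σ).2 (hqs σ) hKlo hK }
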